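/- For graphs $G,G'$ on the vertex set $[n]=\{1,\dots,n\}$ let $G\oplus G'$ be the graph on $[n]$ whose edge set is the symmetric difference of $E(G)$ and $E(G')$. For a finite simple graph $L$ let $M_{L,\mathrm{ind}}(n)$ be the maximum size of a family of graphs on $[n]$ such that, for any two distinct members $G,G'$, the graph $G\oplus G'$ contains an induced subgraph isomorphic to $L$. Theorem. Let $L$ be a finite simple graph with at least one edge and let $\chi(L)$ be its chromatic number. (1) The distance capacity $DC(L,\mathrm{ind})=\lim_{n\to\infty}\frac{2}{n(n-1)}\log_2 M_{L,\mathrm{ind}}(n)$ exists, and $$DC(L,\mathrm{ind})=\frac{1}{\chi(L)-1}.$$ (2) Let $k$ be a fixed positive integer. For $n$ divisible by $k$, among the graphs on $[n]$ that are $k$-partite with prescribed classes $A_1,\dots,A_k$, each of size $n/k$ (every edge joins two different classes), at most $$2^{\left(1-\frac{1}{\chi(L)-1}\right)\frac{n^2}{2}+o(n^2)}$$ do not contain an induced subgraph isomorphic to $L$. Here the $o(n^2)$ term depends only on $k$, $L$ and $n$. -/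

import Mathlib

open Filter Topology Asymptotics
open scoped symmDiff

/-- A class of finite graphs, given by its members on each vertex set `Fin n`. -/
abbrev GraphClass : Type := ∀ n : ℕ, Set (SimpleGraph (Fin n))

/-- A family of graphs on `n` labelled vertices is `𝓕`-good if the symmetric difference (of the
edge sets) of any two distinct members belongs to `𝓕`. -/
def IsGoodFamily (𝓕 : GraphClass) {n : ℕ} (𝓖 : Set (SimpleGraph (Fin n))) : Prop :=
  ∀ G ∈ 𝓖, ∀ G' ∈ 𝓖, G ≠ G' → G ∆ G' ∈ 𝓕 n

/-- `M_𝓕(n)`: the maximum possible size of an `𝓕`-good family on `n` labelled vertices. -/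
noncomputable def maxGoodFamily (𝓕 : GraphClass) (n : ℕ) : ℕ :=
  sSup {m : ℕ | ∃ 𝓖 : Set (SimpleGraph (Fin n)), IsGoodFamily 𝓕 𝓖 ∧ 𝓖.ncard = m}

/-- The supremum defining `maxGoodFamily` is attained: it is a maximum. -/
theorem maxGoodFamily_isGreatest (𝓕 : GraphClass) (n : ℕ) :
    IsGreatest {m : ℕ | ∃ 𝓖 : Set (SimpleGraph (Fin n)), IsGoodFamily 𝓕 𝓖 ∧ 𝓖.ncard = m}
      (maxGoodFamily 𝓕 n) := by
  have hb : BddAbove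
      {m : ℕ | ∃ 𝓖 : Set (SimpleGraph (Fin n)), IsGoodFamily 𝓕 𝓖 ∧ 𝓖.ncard = m} := by
    refine ⟨Nat.card (SimpleGraph (Fin n)), ?_⟩
    rintro m ⟨𝓖, -, rfl⟩
    exact Set.ncard_le_card 𝓖
  refine ⟨Nat.sSup_mem ⟨0, ∅, ?_, by simp⟩ hb, fun m hm => le_csSup hb hm⟩
  intro G hG
  exact absurd hG (Set.notMem_empty G)

/-- The rate `R_𝓛(n) = (2 / (n (n - 1))) log₂ M_𝓛(n)`. -/
noncomputable def rate (𝓛 : GraphClass) (n : ℕ) : ℝ :=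
  2 / ((n : ℝ) * ((n : ℝ) - 1)) * Real.logb 2 (maxGoodFamily 𝓛 n : ℝ)

/-- The distance capacity of `𝓛`, the limit of the rates `R_𝓛(n)`, exists and equals `c`. -/
def HasDistanceCapacity (𝓛 : GraphClass) (c : ℝ) : Prop :=
  Tendsto (rate 𝓛) atTop (𝓝 c)

/-- The class of all graphs that have an induced subgraph isomorphic to `L`. -/
def inducedClass {V : Type*} (L : SimpleGraph V) : GraphClass :=
  fun _ => {H | L.IsIndContained H}

/-- The graphs on `n` labelled vertices that are `k`-partite with the given classes
`A ⁻¹' {0}, …, A ⁻¹' {k - 1}` and have no induced subgraph isomorphic to `L`. -/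
def partiteInducedFree {V : Type*} (L : SimpleGraph V) {n k : ℕ} (A : Fin n → Fin k) :
    Set (SimpleGraph (Fin n)) :=
  {G | (∀ u v, G.Adj u v → A u ≠ A v) ∧ ¬ L.IsIndContained G}

/-- All `k` classes of the partition `A` have the same size `n / k`. -/
def IsBalanced {n k : ℕ} (A : Fin n → Fin k) : Prop :=
  ∀ i : Fin k, k * (A ⁻¹' {i}).ncard = n

/-!
Write `r = χ(L) - 1`.

Counting partite graphs. Let `G` be `k`-partite with no induced copy of `L`. Take a regular
partition of `G` and call a pair of clusters grey if it is regular and its density is bounded away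
from `0` and `1`. Each cluster has a `1 / k` fraction of its vertices in one class of `G`, and this
part is an independent set. Hence `r + 1` pairwise grey clusters would contain an induced `L`, each
colour class embedded greedily into one of these independent sets (`exists_transversal`,
`isIndContained_of_isUniform`). By Turán's theorem the grey pairs cover at most
`(1 - 1 / r + o(1)) n ^ 2 / 2` pairs of vertices. Outside them `G` is almost empty or almost
complete between any two clusters, up to few exceptional pairs (`exists_comap_structure`). So `G` is
determined by bounded data for the clusters, a map from the vertices to the clusters, a sparse graph
of exceptional pairs, and a subgraph of the grey pairs, and only the last choice contributes to the
leading term (`exists_ncard_partiteInducedFree_le`).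

Capacity. For the upper bound, let `T` be the `r`-partite Turán graph: subgraphs of `T` do not
contain `L`, so the members of a good family differ pairwise outside `T`
(`IsGoodFamily.ncard_le`). For the lower bound, `k`-partite graphs with fixed classes are closed
under symmetric differences, and a maximal good family among them has size at least their number
divided by the number of those without an induced `L` (`two_pow_le_maxGoodFamily_mul`). The count
above gives the rate `1 / r - 1 / k - o(1)`, and `k` is arbitrary. Restricting to `k`-partite graphs
is essential: among all graphs, those without an induced `L` can be far more numerous.
-/

/-! ### Counting graphs -/

theorem ncard_setOf_le {V : Type*} [Finite V] (H : SimpleGraph V) :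
    {G : SimpleGraph V | G ≤ H}.ncard = 2 ^ H.edgeSet.ncard := by
  have himage : SimpleGraph.edgeSet '' {G : SimpleGraph V | G ≤ H} = 𝒫 H.edgeSet := by
    ext S
    constructor
    · rintro ⟨G, hG, rfl⟩
      exact SimpleGraph.edgeSet_subset_edgeSet.2 hG
    · intro hS
      have hdiag : (SimpleGraph.fromEdgeSet S).edgeSet = S := by
        rw [SimpleGraph.edgeSet_fromEdgeSet, sdiff_eq_left, Set.disjoint_left]
        exact fun e he => H.not_isDiag_of_mem_edgeSet (hS he)
      exact ⟨_, SimpleGraph.edgeSet_subset_edgeSet.1 (hdiag.subset.trans hS), hdiag⟩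
  rw [← Set.ncard_powerset _ (Set.toFinite _), ← himage,
    Set.ncard_image_of_injective _ SimpleGraph.edgeSet_injective]

/-- The exponential-moment bound for the number of sparse graphs: weight each graph `H` by
`x ^ e(H)` and sum over all sets of unordered pairs. -/
theorem ncard_sparse_mul_rpow_le (n : ℕ) {x s : ℝ} (hx : 0 < x) (hx1 : x ≤ 1) :
    ({H : SimpleGraph (Fin n) | (H.edgeSet.ncard : ℝ) ≤ s}.ncard : ℝ) * x ^ s
      ≤ (1 + x) ^ (n ^ 2) := by
  classical
  set 𝓢 : Finset (SimpleGraph (Fin n)) := {H | (H.edgeSet.ncard : ℝ) ≤ s} with h𝓢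
  have hcard : {H : SimpleGraph (Fin n) | (H.edgeSet.ncard : ℝ) ≤ s}.ncard = 𝓢.card := by
    rw [← Set.ncard_coe_finset]
    simp [h𝓢]
  have hsym : Fintype.card (Sym2 (Fin n)) ≤ n ^ 2 := by
    rw [Sym2.card, Fintype.card_fin, Nat.choose_two_right]
    apply Nat.div_le_of_le_mul
    simp only [Nat.add_sub_cancel]
    nlinarith [Nat.le_self_pow two_ne_zero n]
  calc ({H : SimpleGraph (Fin n) | (H.edgeSet.ncard : ℝ) ≤ s}.ncard : ℝ) * x ^ s
      = ∑ _H ∈ 𝓢, x ^ s := by rw [hcard, Finset.sum_const, nsmul_eq_mul]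
    _ ≤ ∑ H ∈ 𝓢, x ^ H.edgeFinset.card := by
        refine Finset.sum_le_sum fun H hH => ?_
        rw [← Real.rpow_natCast]
        refine Real.rpow_le_rpow_of_exponent_ge hx hx1 ?_
        have := (Finset.mem_filter.1 hH).2
        rwa [Set.ncard_eq_toFinset_card'] at this
    _ = ∑ T ∈ 𝓢.image (fun H => H.edgeFinset), x ^ T.card := by
        rw [Finset.sum_image]
        intro G _ H _ h
        exact SimpleGraph.edgeFinset_inj.1 h
    _ ≤ ∑ T : Finset (Sym2 (Fin n)), x ^ T.card :=
        Finset.sum_le_sum_of_subset_of_nonneg (Finset.subset_univ _) fun _ _ _ => by positivity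
    _ = (1 + x) ^ Fintype.card (Sym2 (Fin n)) := by
        rw [add_comm, ← Fintype.sum_pow_mul_eq_add_pow]
        simp
    _ ≤ (1 + x) ^ (n ^ 2) := pow_le_pow_right₀ (by linarith) hsym

theorem exists_ncard_sparse_le {γ : ℝ} (hγ : 0 < γ) :
    ∃ δ : ℝ, 0 < δ ∧ ∀ n : ℕ,
      ({H : SimpleGraph (Fin n) | (H.edgeSet.ncard : ℝ) ≤ δ * (n : ℝ) ^ 2}.ncard : ℝ)
        ≤ 2 ^ (γ * (n : ℝ) ^ 2) := by
  have hl2 : 0 < Real.log 2 := Real.log_pos one_lt_two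
  obtain ⟨x, hx, hx1, hxγ⟩ : ∃ x : ℝ, 0 < x ∧ x < 1 ∧ x ≤ γ * Real.log 2 / 2 :=
    ⟨min (1 / 2) (γ * Real.log 2 / 2), by positivity,
      (min_le_left _ _).trans_lt (by norm_num), min_le_right _ _⟩
  have hlx : Real.log x < 0 := Real.log_neg hx hx1
  refine ⟨γ * Real.log 2 / 2 / (-Real.log x), by
    have := neg_pos.2 hlx
    positivity, fun n => ?_⟩
  set δ := γ * Real.log 2 / 2 / (-Real.log x) with hδ
  have hδx : δ * Real.log x = -(γ * Real.log 2 / 2) := by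
    rw [hδ, div_mul_eq_mul_div, div_neg, mul_div_cancel_right₀ _ hlx.ne]
  have h := ncard_sparse_mul_rpow_le n (s := δ * (n : ℝ) ^ 2) hx hx1.le
  have hpos : 0 < x ^ (δ * (n : ℝ) ^ 2) := Real.rpow_pos_of_pos hx _
  refine le_of_mul_le_mul_right (h.trans ?_) hpos
  rw [Real.rpow_def_of_pos hx, Real.rpow_def_of_pos two_pos, ← Real.exp_add]
  calc (1 + x) ^ (n ^ 2) ≤ (Real.exp x) ^ (n ^ 2) := by
        gcongr
        linarith [Real.add_one_le_exp x]
    _ = Real.exp ((n : ℝ) ^ 2 * x) := by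
        rw [← Real.exp_nat_mul]; push_cast; rfl
    _ ≤ _ := by
        refine Real.exp_le_exp.2 ?_
        have h1 : Real.log x * (δ * (n : ℝ) ^ 2) = -(γ * Real.log 2 / 2) * (n : ℝ) ^ 2 := by
          rw [← hδx]; ring
        rw [h1]
        nlinarith [mul_le_mul_of_nonneg_left hxγ (sq_nonneg (n : ℝ))]

/-- A graph that differs from `B` outside `g` by a graph in `{H | P H}` is determined by this
difference and by its part inside `g`. -/
theorem ncard_setOf_symmDiff_sdiff_le {V : Type*} [Finite V] (B g : SimpleGraph V)
    (P : SimpleGraph V → Prop) :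
    {G : SimpleGraph V | P ((G ∆ B) \ g)}.ncard ≤ {H | P H}.ncard * 2 ^ g.edgeSet.ncard := by
  rw [← ncard_setOf_le g, ← Set.ncard_prod]
  refine Set.ncard_le_ncard_of_injOn (fun G => ((G ∆ B) \ g, G ⊓ g)) ?_ ?_ (Set.toFinite _)
  · intro G hG
    exact ⟨hG, (inf_le_right : G ⊓ g ≤ g)⟩
  · intro G _ G' _ h
    have h1 : (G ∆ B) \ g = (G' ∆ B) \ g := congrArg Prod.fst h
    have h2 : G ⊓ g = G' ⊓ g := congrArg Prod.snd h
    ext u v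
    have e1 : ((G ∆ B) \ g).Adj u v ↔ ((G' ∆ B) \ g).Adj u v := by rw [h1]
    have e2 : (G ⊓ g).Adj u v ↔ (G' ⊓ g).Adj u v := by rw [h2]
    simp only [symmDiff, SimpleGraph.sdiff_adj, SimpleGraph.sup_adj, SimpleGraph.inf_adj] at e1 e2
    tauto

/-! ### Embedding into regular clusters -/

/-- Greedy embedding. Candidates for one vertex `w₀` that are typical towards every other candidate
set exist, since only `η |C w₀|` of them are atypical towards a given one; fixing a typical
candidate shrinks the other sets by a factor of at most `d`, so `η` grows to `η / d`. -/
theorem exists_transversal {W V : Type*} [DecidableEq W] (R : W → W → V → V → Prop)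
    (hR : ∀ w w' x y, R w w' x y → R w' w y x) [∀ w w' x y, Decidable (R w w' x y)]
    [Nonempty V] {d : ℝ} (hd : 0 < d) (hd1 : d ≤ 1) (S : Finset W) :
    ∀ (C : W → Finset V) (η : ℝ), 0 ≤ η → η * S.card < d ^ S.card →
      (∀ w ∈ S, (C w).Nonempty) →
      (∀ w ∈ S, ∀ w' ∈ S, w ≠ w' → ∀ X ⊆ C w, ∀ Y ⊆ C w',
        η * (C w).card ≤ X.card → η * (C w').card ≤ Y.card →
        d * (X.card * Y.card) ≤ ((X ×ˢ Y).filter fun p => R w w' p.1 p.2).card) →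
      ∃ f : W → V, (∀ w ∈ S, f w ∈ C w) ∧
        ∀ w ∈ S, ∀ w' ∈ S, w ≠ w' → R w w' (f w) (f w') := by
  classical
  induction S using Finset.induction_on with
  | empty =>
    intro C η _ hη _ _
    exact ⟨fun _ => Classical.arbitrary V, by simp, by simp⟩
  | insert w₀ S hw₀ ih =>
    intro C η hη0 hη hne hC
    rw [Finset.card_insert_of_notMem hw₀] at hη
    push_cast at hη
    have hpow : d ^ (S.card + 1) ≤ 1 := pow_le_one₀ hd.le hd1
    have hηS : 0 ≤ η * S.card := by positivity
    have hη1 : η ≤ 1 := by nlinarith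
    have hmem : w₀ ∈ insert w₀ S := Finset.mem_insert_self _ _
    have hsub : ∀ w ∈ S, w ∈ insert w₀ S := fun w => Finset.mem_insert_of_mem
    have hneq : ∀ w ∈ S, w₀ ≠ w := fun w hw h => hw₀ (h ▸ hw)
    let N : W → V → Finset V := fun w x => (C w).filter fun y => R w₀ w x y
    let bad : W → Finset V := fun w => (C w₀).filter fun x => ((N w x).card : ℝ) < d * (C w).card
    have hbad : ∀ w ∈ S, ((bad w).card : ℝ) ≤ η * (C w₀).card := by
      intro w hw
      by_contra! hlt
      have hpos : 0 < (bad w).card := by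
        have : (0 : ℝ) < (bad w).card := lt_of_le_of_lt (by positivity) hlt
        exact_mod_cast this
      have h1 := hC w₀ hmem w (hsub w hw) (hneq w hw) (bad w) (Finset.filter_subset _ _)
        (C w) subset_rfl hlt.le (mul_le_of_le_one_left (by positivity) hη1)
      have h2 : ((bad w ×ˢ C w).filter fun p => R w₀ w p.1 p.2).card
          = ∑ x ∈ bad w, (N w x).card := by
        rw [Finset.card_filter, Finset.sum_product]
        simp only [N, Finset.card_filter]
      have h3 : (∑ x ∈ bad w, ((N w x).card : ℝ)) < ∑ _x ∈ bad w, d * (C w).card :=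
        Finset.sum_lt_sum_of_nonempty (Finset.card_pos.1 hpos)
          fun x hx => (Finset.mem_filter.1 hx).2
      rw [h2] at h1
      push_cast at h1
      rw [Finset.sum_const, nsmul_eq_mul] at h3
      linarith
    obtain ⟨x, hx, hxgood⟩ : ∃ x ∈ C w₀, ∀ w ∈ S, d * (C w).card ≤ (N w x).card := by
      by_contra! hno
      have hcover : C w₀ ⊆ S.biUnion bad := by
        intro x hx
        obtain ⟨w, hw, hlt⟩ := hno x hx
        exact Finset.mem_biUnion.2 ⟨w, hw, Finset.mem_filter.2 ⟨hx, hlt⟩⟩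
      have h1 : ((C w₀).card : ℝ) ≤ ∑ w ∈ S, ((bad w).card : ℝ) := by
        exact_mod_cast (Finset.card_le_card hcover).trans Finset.card_biUnion_le
      have h2 : (∑ w ∈ S, ((bad w).card : ℝ)) ≤ S.card * (η * (C w₀).card) := by
        rw [← nsmul_eq_mul]
        exact Finset.sum_le_card_nsmul _ _ _ hbad
      have h3 : (0 : ℝ) < (C w₀).card := by exact_mod_cast (hne w₀ hmem).card_pos
      nlinarith
    obtain ⟨f, hf, hfR⟩ := ih (fun w => N w x) (η / d) (by positivity)
      (by
        rw [div_mul_eq_mul_div, div_lt_iff₀ hd, ← pow_succ]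
        linarith)
      (fun w hw => by
        have h1 : (0 : ℝ) < (C w).card := by exact_mod_cast (hne w (hsub w hw)).card_pos
        have h2 : (0 : ℝ) < (N w x).card := lt_of_lt_of_le (by positivity) (hxgood w hw)
        exact Finset.card_pos.1 (by exact_mod_cast h2))
      (fun w hw w' hw' hww X hX Y hY hXc hYc => by
        have key : ∀ v ∈ S, η * (C v).card ≤ η / d * (N v x).card := fun v hv => by
          rw [div_mul_eq_mul_div, le_div_iff₀ hd]
          nlinarith [mul_le_mul_of_nonneg_left (hxgood v hv) hη0]
        exact hC w (hsub w hw) w' (hsub w' hw') hww X (hX.trans (Finset.filter_subset _ _))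
          Y (hY.trans (Finset.filter_subset _ _)) ((key w hw).trans hXc) ((key w' hw').trans hYc))
    have hup : ∀ w ∈ S, Function.update f w₀ x w = f w := fun w hw =>
      Function.update_of_ne (hneq w hw).symm _ _
    have hfx : ∀ w ∈ S, R w₀ w x (f w) := fun w hw => (Finset.mem_filter.1 (hf w hw)).2
    refine ⟨Function.update f w₀ x, fun w hw => ?_, fun w hw w' hw' hww => ?_⟩
    · rcases Finset.mem_insert.1 hw with rfl | hw
      · simpa using hx
      · rw [hup w hw]
        exact (Finset.mem_filter.1 (hf w hw)).1
    · rcases Finset.mem_insert.1 hw with h | hwS <;>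
        rcases Finset.mem_insert.1 hw' with h' | hwS'
      · exact (hww (h.trans h'.symm)).elim
      · subst h
        rw [hup w' hwS', Function.update_self]
        exact hfx w' hwS'
      · subst h'
        rw [hup w hwS, Function.update_self]
        exact hR _ _ _ _ (hfx w hwS)
      · rw [hup w hwS, hup w' hwS']
        exact hfR w hwS w' hwS' hww

/-- If the colour classes of `L` are assigned disjoint clusters of a `k`-partite graph `G`, pairwise
regular with densities bounded away from `0` and `1`, then `G` contains `L` as an induced subgraph.
The clusters may be cut down to independent sets, because every cluster has a `1 / k` fraction of
its vertices in a single class of `G`. -/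
theorem isIndContained_of_isUniform {W V ι : Type*} [Fintype W] [DecidableEq V] [Nonempty V]
    {L : SimpleGraph W} (c : L.Coloring ι) {G : SimpleGraph V} [DecidableRel G.Adj] {k : ℕ}
    (A : V → Fin k) (hA : ∀ u v, G.Adj u v → A u ≠ A v) (U : ι → Finset V) {d ε : ℝ}
    (hd : 0 < d) (hd1 : d ≤ 1) (hε : 0 < ε) (hεd : ε ≤ d / 2)
    (hεW : k * ε * Fintype.card W < (d / 2) ^ Fintype.card W)
    (hU : ∀ a, 2 ≤ ε * (U a).card) (hdisj : ∀ a b, a ≠ b → Disjoint (U a) (U b))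
    (hunif : ∀ a b, a ≠ b → G.IsUniform ε (U a) (U b))
    (hlo : ∀ a b, a ≠ b → d ≤ (G.edgeDensity (U a) (U b) : ℝ))
    (hhi : ∀ a b, a ≠ b → (G.edgeDensity (U a) (U b) : ℝ) ≤ 1 - d) :
    L.IsIndContained G := by
  classical
  have hk : 0 < k := Fin.pos (A (Classical.arbitrary V))
  have hk' : (0 : ℝ) < k := by exact_mod_cast hk
  have hmono : ∀ a, ∃ j, ((U a).card : ℝ) ≤ k * ((U a).filter fun v => A v = j).card := by
    intro a
    have : Nonempty (Fin k) := ⟨⟨0, hk⟩⟩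
    obtain ⟨j, -, hj⟩ := Finset.exists_le_card_fiber_of_nsmul_le_card_of_maps_to
      (s := U a) (t := Finset.univ) (f := A) (b := ((U a).card : ℝ) / k)
      (fun _ _ => Finset.mem_univ _) Finset.univ_nonempty
      (by rw [Finset.card_univ, Fintype.card_fin, nsmul_eq_mul, mul_div_cancel₀ _ hk'.ne'])
    exact ⟨j, by rwa [div_le_iff₀' hk'] at hj⟩
  choose j hj using hmono
  let C : ι → Finset V := fun a => (U a).filter fun v => A v = j a
  have hCU : ∀ a, C a ⊆ U a := fun a => Finset.filter_subset _ _
  have hlarge : ∀ a, ∀ X : Finset V, k * ε * (C a).card ≤ X.card → (U a).card * ε ≤ X.card := by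
    intro a X hX
    refine le_trans ?_ hX
    nlinarith [mul_le_mul_of_nonneg_left (hj a) hε.le]
  have hCne : ∀ a, (C a).Nonempty := by
    intro a
    rw [← Finset.card_pos]
    by_contra! h0
    have := hlarge a ∅ (by simp [Nat.le_zero.1 h0])
    have := hU a
    simp only [Finset.card_empty, Nat.cast_zero] at *
    linarith
  obtain ⟨f, hf, hfR⟩ := exists_transversal
    (fun w w' x y => x ≠ y ∧ (G.Adj x y ↔ L.Adj w w'))
    (fun w w' x y h => ⟨h.1.symm, by rw [G.adj_comm, L.adj_comm]; exact h.2⟩)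
    (half_pos hd) (by linarith) (Finset.univ : Finset W) (fun w => C (c w)) (k * ε)
    (by positivity) (by rwa [Finset.card_univ]) (fun w _ => hCne (c w)) (by
      intro w _ w' _ hww X hX Y hY hXc hYc
      have hX2 := hlarge _ X hXc
      have hY2 := hlarge _ Y hYc
      have hYtwo : (2 : ℝ) ≤ Y.card := by linarith [hU (c w')]
      have hX0 : (0 : ℝ) < X.card := by linarith [hU (c w)]
      have hXY : (0 : ℝ) < X.card * Y.card := by positivity
      by_cases hcc : c w = c w'
      · -- Both sets lie in one class of `G`, so only the diagonal pairs are lost.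
        have hL : ¬ L.Adj w w' := fun h => c.valid h hcc
        have heq : ((X ×ˢ Y).filter fun p : V × V =>
            p.1 ≠ p.2 ∧ (G.Adj p.1 p.2 ↔ L.Adj w w')) = (X ×ˢ Y).filter fun p => ¬ p.1 = p.2 := by
          refine Finset.filter_congr fun p hp => and_iff_left ?_
          obtain ⟨hp1, hp2⟩ := Finset.mem_product.1 hp
          have h1 := (Finset.mem_filter.1 (hX hp1)).2
          have h2 := (Finset.mem_filter.1 (hY hp2)).2
          exact iff_of_false (fun h => hA _ _ h (by rw [h1, h2, hcc])) hL
        have hdiag : ((X ×ˢ Y).filter fun p => p.1 = p.2).card ≤ X.card := by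
          refine Finset.card_le_card_of_injOn Prod.fst ?_ ?_
          · intro p hp
            exact (Finset.mem_product.1 (Finset.mem_filter.1 hp).1).1
          · intro p hp q hq hpq
            have h1 := (Finset.mem_filter.1 hp).2
            have h2 := (Finset.mem_filter.1 hq).2
            exact Prod.ext hpq (by rw [← h1, ← h2, hpq])
        have hsum := Finset.card_filter_add_card_filter_not (s := X ×ˢ Y)
          (fun p : V × V => p.1 = p.2)
        rw [Finset.card_product] at hsum
        rw [heq]
        have hsum' : (((X ×ˢ Y).filter fun p => p.1 = p.2).card : ℝ)
            + ((X ×ˢ Y).filter fun p => ¬ p.1 = p.2).card = X.card * Y.card := by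
          exact_mod_cast hsum
        have hdiag' : (((X ×ˢ Y).filter fun p => p.1 = p.2).card : ℝ) ≤ X.card := by
          exact_mod_cast hdiag
        nlinarith
      · have hdis : ∀ p ∈ X ×ˢ Y, p.1 ≠ p.2 := by
          intro p hp h
          obtain ⟨hp1, hp2⟩ := Finset.mem_product.1 hp
          exact Finset.disjoint_left.1 (hdisj _ _ hcc) (hCU _ (hX hp1))
            (h ▸ hCU _ (hY hp2))
        have habs := abs_lt.1 (hunif _ _ hcc (hX.trans (hCU _)) (hY.trans (hCU _)) hX2 hY2)
        have hl := hlo _ _ hcc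
        have hh := hhi _ _ hcc
        have hcast : (G.edgeDensity X Y : ℝ) = (G.interedges X Y).card / (X.card * Y.card) := by
          rw [SimpleGraph.edgeDensity_def]; push_cast; rfl
        have he1 : d / 2 * (X.card * Y.card) ≤ (G.interedges X Y).card := by
          rw [← le_div_iff₀ hXY, ← hcast]; linarith
        have he2 : ((G.interedges X Y).card : ℝ) ≤ (1 - d / 2) * (X.card * Y.card) := by
          rw [← div_le_iff₀ hXY, ← hcast]; linarith
        rw [SimpleGraph.interedges_def] at he1 he2
        by_cases hL : L.Adj w w'
        · have heq : ((X ×ˢ Y).filter fun p : V × V =>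
              p.1 ≠ p.2 ∧ (G.Adj p.1 p.2 ↔ L.Adj w w'))
              = (X ×ˢ Y).filter fun p => G.Adj p.1 p.2 :=
            Finset.filter_congr fun p hp => by simp [hdis p hp, hL]
          rw [heq]
          exact he1
        · have heq : ((X ×ˢ Y).filter fun p : V × V =>
              p.1 ≠ p.2 ∧ (G.Adj p.1 p.2 ↔ L.Adj w w'))
              = (X ×ˢ Y).filter fun p => ¬ G.Adj p.1 p.2 :=
            Finset.filter_congr fun p hp => by simp [hdis p hp, hL]
          have hsum := Finset.card_filter_add_card_filter_not (s := X ×ˢ Y)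
            (fun p : V × V => G.Adj p.1 p.2)
          rw [Finset.card_product] at hsum
          have hsum' : (((X ×ˢ Y).filter fun p => G.Adj p.1 p.2).card : ℝ)
              + ((X ×ˢ Y).filter fun p => ¬ G.Adj p.1 p.2).card = X.card * Y.card := by
            exact_mod_cast hsum
          rw [heq]
          linarith)
  have hinj : Function.Injective f := fun w w' h => by
    by_contra hww
    exact (hfR w (Finset.mem_univ _) w' (Finset.mem_univ _) hww).1 h
  refine ⟨⟨⟨f, hinj⟩, fun {w w'} => ?_⟩⟩
  by_cases hww : w = w'
  · subst hww
    simp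
  · exact (hfR w (Finset.mem_univ _) w' (Finset.mem_univ _) hww).2

/-! ### Regular partitions and the number of partite graphs without an induced copy -/

theorem two_mul_ncard_edgeSet {V : Type*} [Fintype V] (H : SimpleGraph V) [DecidableRel H.Adj] :
    2 * H.edgeSet.ncard = (Finset.univ.filter fun p : V × V => H.Adj p.1 p.2).card := by
  classical
  rw [Set.ncard_eq_toFinset_card', ← SimpleGraph.two_mul_card_edgeFinset]
  rfl

/-- Turán's theorem in the form `2 e(G) ≤ (1 - 1 / r) t ^ 2`. -/
theorem two_mul_ncard_edgeSet_le_of_cliqueFree {V : Type*} [Fintype V] {G : SimpleGraph V} {r : ℕ}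
    (hr : 0 < r) (hG : G.CliqueFree (r + 1)) :
    (2 * G.edgeSet.ncard : ℝ) ≤ (1 - 1 / r) * (Fintype.card V : ℝ) ^ 2 := by
  classical
  have hr' : (0 : ℝ) < r := by exact_mod_cast hr
  have h := hG.card_edgeFinset_le
  simp only at h
  rw [← SimpleGraph.card_edgeFinset_turanGraph] at h
  have h2 := SimpleGraph.mul_card_edgeFinset_turanGraph_le (n := Fintype.card V) (r := r)
  have h3 : 2 * r * G.edgeSet.ncard ≤ (r - 1) * Fintype.card V ^ 2 := by
    rw [Set.ncard_eq_toFinset_card']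
    exact (Nat.mul_le_mul_left _ h).trans h2
  have h4 : (2 * r * G.edgeSet.ncard : ℝ) ≤ (r - 1) * (Fintype.card V : ℝ) ^ 2 := by
    have : ((2 * r * G.edgeSet.ncard : ℕ) : ℝ) ≤ ((r - 1) * Fintype.card V ^ 2 : ℕ) := by
      exact_mod_cast h3
    push_cast [Nat.cast_sub hr] at this
    exact this
  rw [one_sub_div hr'.ne', div_mul_eq_mul_div, le_div_iff₀ hr']
  linarith

/-- A graph blown up along a map whose fibres have at most `m` elements gains a factor of at most
`m ^ 2` in its number of edges. -/
theorem ncard_edgeSet_comap_le {V T : Type*} [Fintype V] [Fintype T] [DecidableEq T]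
    (g : SimpleGraph T) (q : V → T) (m : ℕ)
    (hm : ∀ a, (Finset.univ.filter fun v => q v = a).card ≤ m) :
    2 * (g.comap q).edgeSet.ncard ≤ 2 * g.edgeSet.ncard * m ^ 2 := by
  classical
  rw [two_mul_ncard_edgeSet, two_mul_ncard_edgeSet]
  refine Finset.card_le_mul_card_image_of_maps_to (f := fun p : V × V => (q p.1, q p.2)) ?_ _ ?_
    |>.trans_eq (mul_comm _ _)
  · intro p hp
    simpa using hp
  · rintro ⟨a, b⟩ -
    calc _ ≤ ((Finset.univ.filter fun v => q v = a) ×ˢ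
          (Finset.univ.filter fun v => q v = b)).card := by
            refine Finset.card_le_card fun p hp => ?_
            simpa using (Finset.mem_filter.1 hp).2
      _ ≤ m ^ 2 := by
            rw [Finset.card_product, sq]
            exact Nat.mul_le_mul (hm a) (hm b)

/-- Structure of partite graphs without an induced `L`: up to `δ n ^ 2` edges such a graph is a
blow-up of a bounded graph `b`, except on a blow-up of a bounded graph `g` (recording the regular
pairs of intermediate density), which has few edges. -/
theorem exists_comap_structure {W : Type*} [Fintype W] (L : SimpleGraph W) {r : ℕ} (hr : 0 < r)
    (c : L.Coloring (Fin (r + 1))) (k : ℕ) {δ : ℝ} (hδ : 0 < δ) :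
    ∃ M N : ℕ, ∀ n ≥ N, ∀ A : Fin n → Fin k, ∀ G ∈ partiteInducedFree L A,
      ∃ (p : Fin n → Fin M) (b g : SimpleGraph (Fin M)),
        (((G ∆ b.comap p) \ g.comap p).edgeSet.ncard : ℝ) ≤ δ * (n : ℝ) ^ 2 ∧
        ((g.comap p).edgeSet.ncard : ℝ) ≤ ((1 - 1 / r) / 2 + δ) * (n : ℝ) ^ 2 := by
  classical
  set w := Fintype.card W with hw
  obtain ⟨d, hd, hd1, hdδ⟩ : ∃ d : ℝ, 0 < d ∧ d ≤ 1 / 2 ∧ d ≤ δ / 16 :=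
    ⟨min (1 / 2) (δ / 16), by positivity, min_le_left _ _, min_le_right _ _⟩
  obtain ⟨ε, hε, hεd, hεw⟩ : ∃ ε : ℝ, 0 < ε ∧ ε ≤ d / 2 ∧ k * ε * w < (d / 2) ^ w := by
    refine ⟨min (d / 2) ((d / 2) ^ w / (k * w + 1)), by positivity, min_le_left _ _, ?_⟩
    have h1 := min_le_right (d / 2) ((d / 2) ^ w / (k * w + 1))
    have h2 : (k * w : ℝ) * ((d / 2) ^ w / (k * w + 1)) < (d / 2) ^ w := by
      have h3 : (0 : ℝ) < (d / 2) ^ w := by positivity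
      rw [← mul_div_assoc, div_lt_iff₀ (by positivity)]
      nlinarith
    calc _ = (k * w : ℝ) * min (d / 2) ((d / 2) ^ w / (k * w + 1)) := by ring
      _ ≤ (k * w : ℝ) * ((d / 2) ^ w / (k * w + 1)) := by gcongr
      _ < _ := h2
  set l := ⌈4 / δ⌉₊ with hl
  set M := SzemerediRegularity.bound ε l with hM
  have hMpos : 0 < M := SzemerediRegularity.bound_pos _ _
  have hMpos' : (0 : ℝ) < M := by exact_mod_cast hMpos
  refine ⟨M, max (max (l + M) ⌈M * (2 / ε + 1)⌉₊) ⌈3 * M / δ⌉₊, fun n hn A G hG => ?_⟩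
  simp only [ge_iff_le, max_le_iff] at hn
  obtain ⟨⟨hnlM, hnε⟩, hnδ⟩ := hn
  have hnpos : 0 < n := by omega
  have hn' : (0 : ℝ) < n := by exact_mod_cast hnpos
  have : Nonempty (Fin n) := ⟨⟨0, hnpos⟩⟩
  obtain ⟨P, hPeq, hPl, hPM, hPunif⟩ :=
    szemeredi_regularity G hε (l := l) (by rw [Fintype.card_fin]; omega)
  have hcardn : (Finset.univ : Finset (Fin n)).card = n := by simp
  have htpos : 0 < P.parts.card :=
    (P.parts_nonempty Finset.univ_nonempty.ne_empty).card_pos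
  -- The cluster containing a vertex, first as a part of `P`, then numbered by `Fin M`.
  let q : Fin n → P.parts := fun v => ⟨P.part v, P.part_mem.2 (Finset.mem_univ v)⟩
  have hq : ∀ v (a : P.parts), q v = a ↔ v ∈ a.1 := by
    intro v a
    rw [Subtype.ext_iff]
    constructor
    · intro h
      rw [← h]
      exact P.mem_part (Finset.mem_univ v)
    · exact P.part_eq_of_mem a.2
  have hqmem : ∀ v, v ∈ (q v).1 := fun v => (hq v _).1 rfl
  let e : P.parts ↪ Fin M :=
    (P.parts.equivFin.toEmbedding).trans (Fin.castLEEmb hPM)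
  have hsymm : ∀ a b : Finset (Fin n), (G.edgeDensity a b : ℝ) = G.edgeDensity b a := fun a b => by
    rw [G.edgeDensity_comm]
  -- The pairs of density close to `1`; irregular ones among them do no harm, as they are counted as
  -- exceptional anyway.
  let b : SimpleGraph P.parts :=
    { Adj := fun x y => x ≠ y ∧ 1 - d < (G.edgeDensity x.1 y.1 : ℝ)
      symm := ⟨fun x y h => ⟨h.1.symm, by rw [hsymm]; exact h.2⟩⟩
      loopless := ⟨fun x h => h.1 rfl⟩ }
  let g : SimpleGraph P.parts :=
    { Adj := fun x y => x ≠ y ∧ G.IsUniform ε x.1 y.1 ∧ d ≤ (G.edgeDensity x.1 y.1 : ℝ) ∧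
        (G.edgeDensity x.1 y.1 : ℝ) ≤ 1 - d
      symm := ⟨fun x y h => ⟨h.1.symm, h.2.1.symm, by rw [hsymm]; exact h.2.2⟩⟩
      loopless := ⟨fun x h => h.1 rfl⟩ }
  have hcomap : ∀ H : SimpleGraph P.parts, (H.map e).comap (e ∘ q) = H.comap q := by
    intro H
    conv_rhs => rw [← SimpleGraph.comap_map_eq e H, SimpleGraph.comap_comap]
  refine ⟨e ∘ q, b.map e, g.map e, ?_, ?_⟩
  · rw [hcomap, hcomap]
    -- Exceptional pairs: inside a cluster, between irregular clusters, edges in sparse pairs of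
    -- clusters, and non-edges in dense ones, the last being sparse for the complement.
    have hsub : (Finset.univ.filter fun x : Fin n × Fin n =>
        ((G ∆ b.comap q) \ g.comap q).Adj x.1 x.2) ⊆
        (((P.nonUniforms G ε).biUnion fun (U, V) => U ×ˢ V) ∪ P.parts.biUnion Finset.offDiag) ∪
        (((P.sparsePairs G d).biUnion fun (U, V) => G.interedges U V) ∪
        ((P.sparsePairs Gᶜ d).biUnion fun (U, V) => Gᶜ.interedges U V)) := by
      rintro ⟨u, v⟩ huv
      have hadj := (Finset.mem_filter.1 huv).2
      have huv' := hadj.ne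
      simp only [symmDiff, SimpleGraph.sdiff_adj, SimpleGraph.sup_adj, SimpleGraph.comap_adj]
        at hadj
      simp only [Finset.mem_union, Finset.mem_biUnion, Prod.exists]
      have hu := hqmem u
      have hv := hqmem v
      by_cases hparts : q u = q v
      · exact .inl (.inr ⟨_, (q u).2, Finset.mem_offDiag.2 ⟨hu, hparts ▸ hv, huv'⟩⟩)
      have hparts' : (q u).1 ≠ (q v).1 := fun h => hparts (Subtype.ext h)
      by_cases hun : G.IsUniform ε (q u).1 (q v).1
      · by_cases hlo : d ≤ (G.edgeDensity (q u).1 (q v).1 : ℝ)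
        · have hhi : 1 - d < (G.edgeDensity (q u).1 (q v).1 : ℝ) := by
            by_contra! hle
            exact hadj.2 ⟨hparts, hun, hlo, hle⟩
          have hb : b.Adj (q u) (q v) := ⟨hparts, hhi⟩
          have hnG : ¬ G.Adj u v := by tauto
          have hcompl : (G.edgeDensity (q u).1 (q v).1 : ℝ)
              + (Gᶜ.edgeDensity (q u).1 (q v).1 : ℝ) = 1 := by
            exact_mod_cast G.edgeDensity_add_edgeDensity_compl ⟨u, hu⟩ ⟨v, hv⟩
              (P.disjoint (q u).2 (q v).2 hparts')
          refine .inr (.inr ⟨_, _, Finpartition.mk_mem_sparsePairs _ _ _ _ _ |>.2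
            ⟨(q u).2, (q v).2, hparts', by linarith⟩, ?_⟩)
          exact (SimpleGraph.mk_mem_interedges_iff _).2 ⟨hu, hv, huv', hnG⟩
        · have hnb : ¬ b.Adj (q u) (q v) := fun h => by
            have := h.2
            push Not at hlo
            linarith
          have hG' : G.Adj u v := by tauto
          push Not at hlo
          refine .inr (.inl ⟨_, _, Finpartition.mk_mem_sparsePairs _ _ _ _ _ |>.2
            ⟨(q u).2, (q v).2, hparts', hlo⟩, ?_⟩)
          exact (SimpleGraph.mk_mem_interedges_iff _).2 ⟨hu, hv, hG'⟩
      · exact .inl (.inl ⟨_, _, (Finpartition.mk_mem_nonUniforms _ _).2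
          ⟨(q u).2, (q v).2, hparts', hun⟩, Finset.mem_product.2 ⟨hu, hv⟩⟩)
    have h1 := hPeq.sum_nonUniforms_lt Finset.univ_nonempty hε hPunif
    have h2 := hPeq.card_biUnion_offDiag_le hδ
      ((Nat.le_ceil _).trans (by exact_mod_cast hPl))
    have h3 := hPeq.card_interedges_sparsePairs_le (G := G) hd.le
    have h4 := hPeq.card_interedges_sparsePairs_le (G := Gᶜ) hd.le
    have h5 := (Finset.card_le_card hsub).trans ((Finset.card_union_le _ _).trans
      (add_le_add (Finset.card_union_le _ _) (Finset.card_union_le _ _)))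
    rw [← two_mul_ncard_edgeSet] at h5
    have h6 := (Nat.cast_le (α := ℝ)).2 h5
    push_cast at h6
    rw [hcardn] at h1 h2 h3 h4
    nlinarith [sq_nonneg (n : ℝ)]
  · rw [hcomap]
    -- A clique of `g` on as many clusters as there are colours would accommodate a copy of `L`.
    have hfree : g.CliqueFree (r + 1) := by
      rw [SimpleGraph.cliqueFree_iff]
      refine ⟨fun φ => hG.2 ?_⟩
      have hφ : ∀ i j, i ≠ j → g.Adj (φ i) (φ j) := fun i j hij => φ.toHom.map_adj hij
      refine isIndContained_of_isUniform c A hG.1 (fun i => (φ i).1) hd (by linarith) hε hεd hεw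
        ?_ (fun i j hij => P.disjoint (φ i).2 (φ j).2
          fun h => (hφ i j hij).1 (Subtype.ext h)) (fun i j hij => (hφ i j hij).2.1)
        (fun i j hij => (hφ i j hij).2.2.1) (fun i j hij => (hφ i j hij).2.2.2)
      intro i
      have h1 := hPeq.average_le_card_part (φ i).2
      rw [hcardn] at h1
      have h2 : n / M ≤ (φ i).1.card := (Nat.div_le_div_left hPM htpos).trans h1
      have h3 : (n : ℝ) / M < (n / M : ℕ) + 1 := by
        rw [div_lt_iff₀ hMpos']
        exact_mod_cast Nat.lt_mul_of_div_lt (Nat.lt_succ_self (n / M)) hMpos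
      have h4 : M * (2 / ε + 1) ≤ (n : ℝ) := Nat.ceil_le.1 hnε
      have h5 : 2 / ε + 1 ≤ (n : ℝ) / M := by
        rw [le_div_iff₀ hMpos']
        linarith
      have h6 : ((n / M : ℕ) : ℝ) ≤ (φ i).1.card := by exact_mod_cast h2
      rw [← div_le_iff₀' hε]
      linarith
    have hturan := two_mul_ncard_edgeSet_le_of_cliqueFree hr hfree
    rw [Fintype.card_coe] at hturan
    have hblow := ncard_edgeSet_comap_le g q (n / P.parts.card + 1) (fun a => by
      have h1 := hPeq.card_part_le_average_add_one a.2
      rw [hcardn] at h1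
      refine (Finset.card_le_card fun v hv => ?_).trans h1
      exact (hq v a).1 (Finset.mem_filter.1 hv).2)
    have hblow' := (Nat.cast_le (α := ℝ)).2 hblow
    push_cast at hblow'
    have hr' : (1 : ℝ) ≤ r := by exact_mod_cast hr
    have hcoef : (0 : ℝ) ≤ 1 - 1 / r := by
      rw [sub_nonneg, div_le_one (by linarith)]
      exact hr'
    have hcoef1 : (1 : ℝ) - 1 / r ≤ 1 := by
      have : (0 : ℝ) ≤ 1 / r := by positivity
      linarith
    have hm : (P.parts.card : ℝ) * ((n / P.parts.card : ℕ) + 1) ≤ n + M := by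
      have h1 : P.parts.card * (n / P.parts.card) ≤ n := Nat.mul_div_le _ _
      have h2 : (P.parts.card : ℝ) * (n / P.parts.card : ℕ) ≤ n := by exact_mod_cast h1
      have h3 : (P.parts.card : ℝ) ≤ M := by exact_mod_cast hPM
      linarith
    have hMn : (M : ℝ) ≤ n := by exact_mod_cast (by omega : M ≤ n)
    have hMδ : 3 * M ≤ δ * (n : ℝ) := by
      have := Nat.ceil_le.1 hnδ
      rwa [div_le_iff₀' hδ] at this
    have hfinal : (2 * (g.comap q).edgeSet.ncard : ℝ) ≤ (1 - 1 / r) * (n : ℝ) ^ 2 + δ * n ^ 2 := by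
      calc _ ≤ _ := hblow'
        _ ≤ (1 - 1 / r) * (P.parts.card : ℝ) ^ 2 * ((n / P.parts.card : ℕ) + 1) ^ 2 := by gcongr
        _ = (1 - 1 / r) * ((P.parts.card : ℝ) * ((n / P.parts.card : ℕ) + 1)) ^ 2 := by ring
        _ ≤ (1 - 1 / r) * (n + M) ^ 2 := by gcongr
        _ = (1 - 1 / r) * (n : ℝ) ^ 2 + (1 - 1 / r) * (2 * n * M + M * M) := by ring
        _ ≤ (1 - 1 / r) * (n : ℝ) ^ 2 + 1 * (2 * n * M + n * M) := by gcongr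
        _ = (1 - 1 / r) * (n : ℝ) ^ 2 + n * (3 * M) := by ring
        _ ≤ (1 - 1 / r) * (n : ℝ) ^ 2 + n * (δ * n) := by gcongr
        _ = _ := by ring
    have : 0 ≤ δ * (n : ℝ) ^ 2 := by positivity
    linarith

/-- The boundedly many blow-up structures contribute `2 ^ O(n)` choices, the exceptional edges
`2 ^ o(n ^ 2)`, and the edges inside the blow-up of `g` give the main term. The partition `A` need
not be balanced. -/
theorem exists_ncard_partiteInducedFree_le {W : Type*} [Fintype W] (L : SimpleGraph W) {r : ℕ}
    (hr : 0 < r) (c : L.Coloring (Fin (r + 1))) (k : ℕ) {γ : ℝ} (hγ : 0 < γ) :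
    ∃ N : ℕ, ∀ n ≥ N, ∀ A : Fin n → Fin k,
      ((partiteInducedFree L A).ncard : ℝ) ≤ 2 ^ (((1 - 1 / r) / 2 + γ) * (n : ℝ) ^ 2) := by
  classical
  have hγ3 : 0 < γ / 3 := by positivity
  obtain ⟨δ, hδ, hsparse⟩ := exists_ncard_sparse_le hγ3
  obtain ⟨M, N, hstruct⟩ := exists_comap_structure L hr c k (lt_min hδ hγ3)
  let K := Fintype.card (SimpleGraph (Fin M))
  refine ⟨max (max N 1) ⌈(M + K + K : ℝ) / (γ / 3)⌉₊, fun n hn A => ?_⟩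
  simp only [ge_iff_le, max_le_iff] at hn
  obtain ⟨⟨hnN, hn1⟩, hnK⟩ := hn
  -- `F (p, b, g)` consists of the graphs described by the structural data `(p, b, g)`.
  let F : (Fin n → Fin M) × SimpleGraph (Fin M) × SimpleGraph (Fin M) → Set (SimpleGraph (Fin n)) :=
    fun t => {G | (((G ∆ t.2.1.comap t.1) \ t.2.2.comap t.1).edgeSet.ncard : ℝ) ≤ δ * (n : ℝ) ^ 2 ∧
      ((t.2.2.comap t.1).edgeSet.ncard : ℝ) ≤ ((1 - 1 / r) / 2 + γ / 3) * (n : ℝ) ^ 2}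
  have hcover : partiteInducedFree L A ⊆ ⋃ t, F t := by
    intro G hG
    obtain ⟨p, b, g, h1, h2⟩ := hstruct n hnN A G hG
    refine Set.mem_iUnion.2 ⟨(p, b, g), h1.trans ?_, h2.trans ?_⟩
    · gcongr
      exact min_le_left _ _
    · gcongr
      exact min_le_right _ _
  have hF : ∀ t, ((F t).ncard : ℝ) ≤ 2 ^ (((1 - 1 / r) / 2 + γ / 3 + γ / 3) * (n : ℝ) ^ 2) := by
    intro t
    by_cases ht : ((t.2.2.comap t.1).edgeSet.ncard : ℝ) ≤ ((1 - 1 / r) / 2 + γ / 3) * (n : ℝ) ^ 2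
    · have h1 := (Set.ncard_le_ncard (fun G (hG : G ∈ F t) => hG.1) (Set.toFinite _)).trans
        (ncard_setOf_symmDiff_sdiff_le (t.2.1.comap t.1) (t.2.2.comap t.1)
          fun H => (H.edgeSet.ncard : ℝ) ≤ δ * (n : ℝ) ^ 2)
      have h2 := (Nat.cast_le (α := ℝ)).2 h1
      push_cast at h2
      refine h2.trans ?_
      rw [add_mul _ (γ / 3), Real.rpow_add two_pos, mul_comm ((2 : ℝ) ^ (_ * _))]
      refine mul_le_mul (hsparse n) ?_ (by positivity) (by positivity)
      rw [← Real.rpow_natCast]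
      exact Real.rpow_le_rpow_of_exponent_le one_le_two ht
    · have : F t = ∅ := Set.eq_empty_of_forall_notMem fun G hG => ht hG.2
      rw [this, Set.ncard_empty, Nat.cast_zero]
      positivity
  have hcodes : (Fintype.card ((Fin n → Fin M) × SimpleGraph (Fin M) × SimpleGraph (Fin M)) : ℝ)
      ≤ 2 ^ (γ / 3 * (n : ℝ) ^ 2) := by
    have h1 : Fintype.card ((Fin n → Fin M) × SimpleGraph (Fin M) × SimpleGraph (Fin M))
        = M ^ n * (K * K) := by
      simp [K]
    have h2 : M ^ n * (K * K) ≤ 2 ^ ((M + K + K) * n) := by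
      have hK : K ≤ (2 ^ K) ^ n := Nat.lt_two_pow_self.le.trans (Nat.le_self_pow (by omega) _)
      calc M ^ n * (K * K) ≤ (2 ^ M) ^ n * ((2 ^ K) ^ n * (2 ^ K) ^ n) := by
            gcongr
            exact Nat.lt_two_pow_self.le
        _ = 2 ^ ((M + K + K) * n) := by
            rw [← mul_pow, ← mul_pow, ← pow_add, ← pow_add, ← pow_mul, add_assoc]
    have h3 : (M + K + K : ℝ) ≤ γ / 3 * n := by
      have := Nat.ceil_le.1 hnK
      rwa [div_le_iff₀' hγ3] at this
    rw [h1]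
    calc ((M ^ n * (K * K) : ℕ) : ℝ) ≤ ((2 ^ ((M + K + K) * n) : ℕ) : ℝ) := by exact_mod_cast h2
      _ = 2 ^ (((M + K + K : ℝ)) * n) := by
          rw [Nat.cast_pow, Nat.cast_ofNat, ← Real.rpow_natCast]
          push_cast
          rfl
      _ ≤ 2 ^ (γ / 3 * (n : ℝ) ^ 2) := by
          refine Real.rpow_le_rpow_of_exponent_le one_le_two ?_
          rw [sq, ← mul_assoc]
          gcongr
  have hunion := (Set.ncard_le_ncard hcover (Set.toFinite _)).trans
    (Set.ncard_iUnion_le_of_fintype F)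
  calc ((partiteInducedFree L A).ncard : ℝ) ≤ ∑ t, ((F t).ncard : ℝ) := by exact_mod_cast hunion
    _ ≤ ∑ _t : (Fin n → Fin M) × SimpleGraph (Fin M) × SimpleGraph (Fin M),
          (2 : ℝ) ^ (((1 - 1 / r) / 2 + γ / 3 + γ / 3) * (n : ℝ) ^ 2) :=
        Finset.sum_le_sum fun t _ => hF t
    _ ≤ 2 ^ (γ / 3 * (n : ℝ) ^ 2)
          * 2 ^ (((1 - 1 / r) / 2 + γ / 3 + γ / 3) * (n : ℝ) ^ 2) := by
        rw [Finset.sum_const, nsmul_eq_mul, Finset.card_univ]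
        gcongr
    _ = _ := by
        rw [← Real.rpow_add two_pos]
        ring_nf

/-- Uniformly in the classes, the error in the exponent is `o(n ^ 2)`: take for `e n` the worst
excess of the exponent over all choices of the classes. -/
theorem exists_isLittleO_ncard_partiteInducedFree_le {W : Type*} [Fintype W] (L : SimpleGraph W)
    {r : ℕ} (hr : 0 < r) (c : L.Coloring (Fin (r + 1))) {k : ℕ} (hk : 0 < k) :
    ∃ e : ℕ → ℝ, e =o[atTop] (fun n : ℕ => (n : ℝ) ^ 2) ∧
      ∀ (n : ℕ) (A : Fin n → Fin k),
        ((partiteInducedFree L A).ncard : ℝ) ≤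
          (2 : ℝ) ^ ((1 - 1 / (r : ℝ)) * (n : ℝ) ^ 2 / 2 + e n) := by
  have : Nonempty (Fin k) := ⟨⟨0, hk⟩⟩
  let E : ∀ n : ℕ, (Fin n → Fin k) → ℝ := fun n A =>
    max 0 (Real.logb 2 (partiteInducedFree L A).ncard - (1 - 1 / (r : ℝ)) * (n : ℝ) ^ 2 / 2)
  refine ⟨fun n => Finset.univ.sup' Finset.univ_nonempty (E n), ?_, fun n A => ?_⟩
  · rw [isLittleO_iff]
    intro γ hγ
    obtain ⟨N, hN⟩ := exists_ncard_partiteInducedFree_le L hr c k hγ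
    filter_upwards [eventually_ge_atTop N] with n hn
    have h0 : 0 ≤ Finset.univ.sup' Finset.univ_nonempty (E n) :=
      (le_max_left _ _).trans (Finset.le_sup' (E n)
        (Finset.mem_univ (Classical.arbitrary (Fin n → Fin k))))
    rw [Real.norm_of_nonneg h0, Real.norm_of_nonneg (by positivity)]
    refine Finset.sup'_le _ _ fun A _ => max_le (by positivity) ?_
    have h1 := hN n hn A
    rcases Nat.eq_zero_or_pos (partiteInducedFree L A).ncard with hz | hpos
    · have hr' : (1 : ℝ) ≤ r := by exact_mod_cast hr
      have hcoef : (0 : ℝ) ≤ 1 - 1 / r := by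
        rw [sub_nonneg, div_le_one (by linarith)]
        exact hr'
      have : 0 ≤ (1 - 1 / (r : ℝ)) * (n : ℝ) ^ 2 / 2 := by positivity
      have : 0 ≤ γ * (n : ℝ) ^ 2 := by positivity
      rw [hz, Nat.cast_zero, Real.logb_zero]
      linarith
    · rw [← Real.logb_le_iff_le_rpow one_lt_two (by exact_mod_cast hpos)] at h1
      linarith
  · have h1 := (le_max_right _ _).trans (Finset.le_sup' (E n) (Finset.mem_univ A))
    rcases Nat.eq_zero_or_pos (partiteInducedFree L A).ncard with hz | hpos
    · rw [hz, Nat.cast_zero]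
      positivity
    · rw [← Real.logb_le_iff_le_rpow one_lt_two (by exact_mod_cast hpos)]
      linarith

/-! ### Distance capacity -/

theorem turanGraph_colorable {r : ℕ} (hr : 0 < r) (n : ℕ) :
    (SimpleGraph.turanGraph n r).Colorable r :=
  ⟨SimpleGraph.Coloring.mk (fun v => ⟨v % r, Nat.mod_lt _ hr⟩)
    fun {_ _} h => fun h' => h (Fin.mk.inj_iff.1 h')⟩

theorem le_ncard_edgeSet_turanGraph {r : ℕ} (hr : 0 < r) (n : ℕ) :
    (1 - 1 / (r : ℝ)) / 2 * (n : ℝ) ^ 2 - (r ^ 2 + 1)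
      ≤ (SimpleGraph.turanGraph n r).edgeSet.ncard := by
  have hr' : (0 : ℝ) < r := by exact_mod_cast hr
  have hr1 : (1 : ℝ) ≤ r := by exact_mod_cast hr
  have hmod : n % r < r := Nat.mod_lt _ hr
  have hle : n % r ≤ n := Nat.mod_le _ _
  have hcard : (SimpleGraph.turanGraph n r).edgeSet.ncard
      = (n ^ 2 - (n % r) ^ 2) * (r - 1) / (2 * r) + (n % r).choose 2 := by
    rw [Set.ncard_eq_toFinset_card', ← SimpleGraph.card_edgeFinset_turanGraph]
    rfl
  have hfloor : ((n ^ 2 - (n % r : ℕ) ^ 2) * (r - 1) : ℝ) / (2 * r) - 1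
      ≤ ((n ^ 2 - (n % r) ^ 2) * (r - 1) / (2 * r) : ℕ) := by
    have h1 := Nat.lt_mul_of_div_lt
      (Nat.lt_succ_self ((n ^ 2 - (n % r) ^ 2) * (r - 1) / (2 * r))) (by omega : 0 < 2 * r)
    have h2 := (Nat.cast_lt (α := ℝ)).2 h1
    push_cast [Nat.cast_sub hr, Nat.cast_sub (Nat.pow_le_pow_left hle 2)] at h2
    rw [sub_le_iff_le_add, div_le_iff₀ (by positivity)]
    exact h2.le
  have hchoose : (0 : ℝ) ≤ ((n % r).choose 2 : ℕ) := Nat.cast_nonneg _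
  have hmod2 : ((n % r : ℕ) : ℝ) ^ 2 ≤ (r : ℝ) ^ 2 := by
    have : ((n % r : ℕ) : ℝ) ≤ r := by exact_mod_cast hmod.le
    gcongr
  have hsplit : ((n ^ 2 - (n % r : ℕ) ^ 2) * (r - 1) : ℝ) / (2 * r)
      = (1 - 1 / (r : ℝ)) / 2 * n ^ 2 - (1 - 1 / (r : ℝ)) / 2 * (n % r : ℕ) ^ 2 := by
    field_simp
  have hcoef : (1 - 1 / (r : ℝ)) / 2 ≤ 1 := by
    have : (0 : ℝ) ≤ 1 / r := by positivity
    linarith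
  have hlast : (1 - 1 / (r : ℝ)) / 2 * (n % r : ℕ) ^ 2 ≤ r ^ 2 := by
    nlinarith [sq_nonneg ((n % r : ℕ) : ℝ)]
  rw [hcard, Nat.cast_add]
  linarith

/-- A good family injects into the subgraphs of the complement of `T`, if no subgraph of `T` belongs
to the class: two members that agree outside `T` differ by a subgraph of `T`. -/
theorem IsGoodFamily.ncard_le {𝓕 : GraphClass} {n : ℕ} {𝓖 : Set (SimpleGraph (Fin n))}
    (h𝓖 : IsGoodFamily 𝓕 𝓖) (T : SimpleGraph (Fin n)) (hT : ∀ H ≤ T, H ∉ 𝓕 n) :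
    𝓖.ncard ≤ 2 ^ Tᶜ.edgeSet.ncard := by
  rw [← ncard_setOf_le]
  refine Set.ncard_le_ncard_of_injOn (fun G => G \ T) ?_ ?_ (Set.toFinite _)
  · intro G _
    rw [Set.mem_ofPred_eq, sdiff_eq]
    exact inf_le_right
  · intro G hG G' hG' h
    by_contra hne
    refine hT _ ?_ (h𝓖 G hG G' hG' hne)
    have h' : G \ T = G' \ T := h
    refine sup_le ?_ ?_
    · rw [sdiff_le_iff, ← sdiff_le_iff', h']
      exact sdiff_le
    · rw [sdiff_le_iff, ← sdiff_le_iff', ← h']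
      exact sdiff_le

theorem ncard_edgeSet_add_compl_le {n : ℕ} (T : SimpleGraph (Fin n)) :
    (T.edgeSet.ncard + Tᶜ.edgeSet.ncard : ℝ) ≤ (n : ℝ) ^ 2 / 2 := by
  classical
  have h : T.edgeSet.ncard + Tᶜ.edgeSet.ncard ≤ n.choose 2 := by
    rw [← Set.ncard_union_eq (SimpleGraph.disjoint_edgeSet.2 disjoint_compl_right) (Set.toFinite _)
      (Set.toFinite _), ← SimpleGraph.edgeSet_sup, Set.ncard_eq_toFinset_card']
    have := SimpleGraph.card_edgeFinset_le_card_choose_two (G := T ⊔ Tᶜ)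
    rw [Fintype.card_fin] at this
    convert! this
  have h2 : (n.choose 2 : ℝ) ≤ (n : ℝ) ^ 2 / 2 := by
    rw [Nat.cast_choose_two]
    nlinarith [Nat.cast_nonneg (α := ℝ) n]
  exact le_trans (by exact_mod_cast h) h2

theorem one_le_maxGoodFamily (𝓕 : GraphClass) (n : ℕ) : 1 ≤ maxGoodFamily 𝓕 n :=
  (maxGoodFamily_isGreatest 𝓕 n).2 ⟨{⊥}, by
    rintro G rfl G' rfl h
    exact (h rfl).elim, Set.ncard_singleton _⟩

theorem logb_maxGoodFamily_le {W : Type*} (L : SimpleGraph W) {r : ℕ} (hr : 0 < r)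
    (hL : ¬ L.Colorable r) (n : ℕ) :
    Real.logb 2 (maxGoodFamily (inducedClass L) n) ≤ 1 / (r : ℝ) / 2 * n ^ 2 + (r ^ 2 + 1) := by
  obtain ⟨⟨𝓖, h𝓖, hcard⟩, -⟩ := maxGoodFamily_isGreatest (inducedClass L) n
  have h1 := h𝓖.ncard_le (SimpleGraph.turanGraph n r) fun H hH hLH =>
    hL (SimpleGraph.Colorable.of_hom hLH.some.toHom ((turanGraph_colorable hr n).mono_left hH))
  rw [hcard] at h1
  have hpos : (0 : ℝ) < maxGoodFamily (inducedClass L) n := by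
    exact_mod_cast one_le_maxGoodFamily (inducedClass L) n
  have h2 : Real.logb 2 (maxGoodFamily (inducedClass L) n)
      ≤ (SimpleGraph.turanGraph n r)ᶜ.edgeSet.ncard := by
    rw [Real.logb_le_iff_le_rpow one_lt_two hpos, Real.rpow_natCast]
    exact_mod_cast h1
  have h3 := ncard_edgeSet_add_compl_le (SimpleGraph.turanGraph n r)
  have h4 := le_ncard_edgeSet_turanGraph hr n
  linarith

/-- Gilbert–Varshamov bound inside the subgraphs of `K`: the translates of the graphs outside `𝓕`
by the members of a maximal good family cover all subgraphs of `K`. -/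
theorem two_pow_le_maxGoodFamily_mul {𝓕 : GraphClass} {n : ℕ} (hbot : ⊥ ∉ 𝓕 n)
    (K : SimpleGraph (Fin n)) :
    2 ^ K.edgeSet.ncard ≤ maxGoodFamily 𝓕 n * {H | H ≤ K ∧ H ∉ 𝓕 n}.ncard := by
  classical
  obtain ⟨𝓖, h𝓖⟩ := (Set.toFinite {𝓖 : Set (SimpleGraph (Fin n)) |
    IsGoodFamily 𝓕 𝓖 ∧ ∀ G ∈ 𝓖, G ≤ K}).exists_maximal
    ⟨∅, fun G hG => hG.elim, fun G hG => hG.elim⟩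
  have hcover : ∀ H ≤ K, ∃ G ∈ 𝓖, G ∆ H ∉ 𝓕 n := by
    intro H hH
    by_contra! hno
    have hgood : insert H 𝓖 ∈ {𝓖 : Set (SimpleGraph (Fin n)) |
        IsGoodFamily 𝓕 𝓖 ∧ ∀ G ∈ 𝓖, G ≤ K} := by
      constructor
      · rintro G (rfl | hG) G' (rfl | hG') hne
        · exact (hne rfl).elim
        · rw [symmDiff_comm]
          exact hno G' hG'
        · exact hno G hG
        · exact h𝓖.prop.1 G hG G' hG' hne
      · rintro G (rfl | hG)
        · exact hH
        · exact h𝓖.prop.2 G hG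
    -- By maximality `H` is itself a member, but `H ∆ H = ⊥`.
    have hmem : H ∈ 𝓖 := h𝓖.le_of_ge hgood (Set.subset_insert _ _) (Set.mem_insert _ _)
    exact hbot (by simpa using hno H hmem)
  have hsub : {H | H ≤ K} ⊆
      (fun q : SimpleGraph (Fin n) × SimpleGraph (Fin n) => q.1 ∆ q.2) ''
        (𝓖 ×ˢ {H | H ≤ K ∧ H ∉ 𝓕 n}) := by
    intro H hH
    obtain ⟨G, hG, hbad⟩ := hcover H hH
    refine ⟨(G, G ∆ H), ⟨hG, ?_, hbad⟩, symmDiff_symmDiff_cancel_left _ _⟩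
    exact symmDiff_le_sup.trans (sup_le (h𝓖.prop.2 G hG) hH)
  calc 2 ^ K.edgeSet.ncard = {H | H ≤ K}.ncard := (ncard_setOf_le K).symm
    _ ≤ _ := Set.ncard_le_ncard hsub (Set.toFinite _)
    _ ≤ (𝓖 ×ˢ {H | H ≤ K ∧ H ∉ 𝓕 n}).ncard := Set.ncard_image_le (Set.toFinite _)
    _ = 𝓖.ncard * {H | H ≤ K ∧ H ∉ 𝓕 n}.ncard := Set.ncard_prod
    _ ≤ _ := Nat.mul_le_mul_right _ ((maxGoodFamily_isGreatest 𝓕 n).2 ⟨𝓖, h𝓖.prop.1, rfl⟩)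

/-- Compared with `logb_maxGoodFamily_le` there is a loss of `1 / k` in the rate, because only
`k`-partite graphs are used; `k` is arbitrary. -/
theorem exists_le_logb_maxGoodFamily {W : Type*} [Fintype W] (L : SimpleGraph W) (hL : L ≠ ⊥)
    {r : ℕ} (hr : 0 < r) (c : L.Coloring (Fin (r + 1))) {k : ℕ} (hk : 0 < k) {γ : ℝ}
    (hγ : 0 < γ) :
    ∃ N : ℕ, ∀ n ≥ N, (1 / (r : ℝ) - 1 / k - 2 * γ) / 2 * n ^ 2 + -(k ^ 2 + 1)
      ≤ Real.logb 2 (maxGoodFamily (inducedClass L) n) := by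
  obtain ⟨N, hN⟩ := exists_ncard_partiteInducedFree_le L hr c k hγ
  refine ⟨N, fun n hn => ?_⟩
  have hbot : (⊥ : SimpleGraph (Fin n)) ∉ inducedClass L n := by
    rintro ⟨φ⟩
    refine hL (SimpleGraph.ext ?_)
    funext u v
    exact propext ⟨fun h => (φ.map_rel_iff.2 h).elim, fun h => h.elim⟩
  have h1 := two_pow_le_maxGoodFamily_mul hbot (SimpleGraph.turanGraph n k)
  let A : Fin n → Fin k := fun v => ⟨v % k, Nat.mod_lt _ hk⟩
  have hsub : {H | H ≤ SimpleGraph.turanGraph n k ∧ H ∉ inducedClass L n}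
      ⊆ partiteInducedFree L A := fun H hH =>
    ⟨fun u v huv h => hH.1 huv (Fin.mk.inj_iff.1 h), hH.2⟩
  have h2 := h1.trans (Nat.mul_le_mul_left _ (Set.ncard_le_ncard hsub (Set.toFinite _)))
  have h3 : (2 : ℝ) ^ (SimpleGraph.turanGraph n k).edgeSet.ncard
      ≤ maxGoodFamily (inducedClass L) n * 2 ^ (((1 - 1 / (r : ℝ)) / 2 + γ) * (n : ℝ) ^ 2) := by
    have h4 : ((2 ^ (SimpleGraph.turanGraph n k).edgeSet.ncard : ℕ) : ℝ)
        ≤ (maxGoodFamily (inducedClass L) n * (partiteInducedFree L A).ncard : ℕ) := by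
      exact_mod_cast h2
    push_cast at h4
    exact h4.trans (mul_le_mul_of_nonneg_left (hN n hn A) (Nat.cast_nonneg _))
  have hpos : (0 : ℝ) < maxGoodFamily (inducedClass L) n := by
    exact_mod_cast one_le_maxGoodFamily (inducedClass L) n
  have h5 := Real.logb_le_logb_of_le one_lt_two (by positivity) h3
  rw [Real.logb_mul hpos.ne' (by positivity), Real.logb_rpow two_pos (by norm_num),
    ← Real.rpow_natCast, Real.logb_rpow two_pos (by norm_num)] at h5
  have h6 := le_ncard_edgeSet_turanGraph hk n
  linarith

theorem tendsto_two_div_mul_quadratic (a C : ℝ) :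
    Tendsto (fun n : ℕ => 2 / ((n : ℝ) * ((n : ℝ) - 1)) * (a / 2 * (n : ℝ) ^ 2 + C)) atTop
      (𝓝 a) := by
  have h1 : Tendsto (fun n : ℕ => (n : ℝ) / (n + -1)) atTop (𝓝 1) :=
    tendsto_natCast_div_add_atTop (-1)
  have h2 : Tendsto (fun n : ℕ => ((n : ℝ))⁻¹) atTop (𝓝 0) := tendsto_inv_atTop_nhds_zero_nat
  have h3 : Tendsto (fun n : ℕ => a * ((n : ℝ) / (n + -1))
      + 2 * C * (((n : ℝ) / (n + -1)) * ((n : ℝ)⁻¹ * (n : ℝ)⁻¹))) atTop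
      (𝓝 (a * 1 + 2 * C * (1 * (0 * 0)))) :=
    (h1.const_mul a).add ((h1.mul (h2.mul h2)).const_mul (2 * C))
  simp only [mul_one, mul_zero, add_zero] at h3
  refine h3.congr' ?_
  filter_upwards [eventually_ge_atTop 2] with n hn
  have hn' : (2 : ℝ) ≤ n := by exact_mod_cast hn
  have h4 : (n : ℝ) ≠ 0 := by linarith
  have h5 : (n : ℝ) - 1 ≠ 0 := by
    intro h
    linarith
  rw [← sub_eq_add_neg]
  field_simp

theorem hasDistanceCapacity_inducedClass {W : Type*} [Fintype W] (L : SimpleGraph W) (hL : L ≠ ⊥)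
    {r : ℕ} (hr : 0 < r) (c : L.Coloring (Fin (r + 1))) (hr' : ¬ L.Colorable r) :
    HasDistanceCapacity (inducedClass L) (1 / (r : ℝ)) := by
  have hscale : ∀ n : ℕ, 1 ≤ n → (0 : ℝ) ≤ 2 / ((n : ℝ) * ((n : ℝ) - 1)) := by
    intro n hn
    have hn' : (1 : ℝ) ≤ n := by exact_mod_cast hn
    have : (0 : ℝ) ≤ (n : ℝ) - 1 := by linarith
    positivity
  refine tendsto_order.2 ⟨fun a ha => ?_, fun a ha => ?_⟩
  · obtain ⟨k, hk⟩ := exists_nat_one_div_lt (show (0 : ℝ) < (1 / (r : ℝ) - a) / 3 by linarith)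
    have hγ : 0 < (1 / (r : ℝ) - a) / 6 := by linarith
    obtain ⟨N, hN⟩ := exists_le_logb_maxGoodFamily L hL hr c k.succ_pos hγ
    push_cast at hN
    have hlim := tendsto_two_div_mul_quadratic
      (1 / (r : ℝ) - 1 / (k + 1) - 2 * ((1 / (r : ℝ) - a) / 6)) (-((k + 1) ^ 2 + 1))
    filter_upwards [(tendsto_order.1 hlim).1 a (by linarith), eventually_ge_atTop N,
      eventually_ge_atTop 1] with n h1 h2 h3
    exact h1.trans_le (mul_le_mul_of_nonneg_left (hN n h2) (hscale n h3))
  · filter_upwards [(tendsto_order.1 (tendsto_two_div_mul_quadratic (1 / (r : ℝ)) (r ^ 2 + 1))).2 a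
      ha, eventually_ge_atTop 1] with n h1 h2
    exact (mul_le_mul_of_nonneg_left (logb_maxGoodFamily_le L hr hr' n) (hscale n h2)).trans_lt h1

theorem mainTheorem2 {V : Type*} [Finite V] (L : SimpleGraph V) (hL : L ≠ ⊥) :
    HasDistanceCapacity (inducedClass L) (1 / ((L.chromaticNumber.toNat : ℝ) - 1)) ∧
    ∀ k : ℕ, 0 < k →
      ∃ e : ℕ → ℝ, e =o[atTop] (fun n : ℕ => (n : ℝ) ^ 2) ∧
        ∀ (n : ℕ) (A : Fin n → Fin k), IsBalanced A →
          ((partiteInducedFree L A).ncard : ℝ) ≤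
            (2 : ℝ) ^ ((1 - 1 / ((L.chromaticNumber.toNat : ℝ) - 1)) * (n : ℝ) ^ 2 / 2 + e n) := by
  cases nonempty_fintype V
  have hcol := L.colorable_chromaticNumber_of_fintype
  have htwo : 2 ≤ L.chromaticNumber := SimpleGraph.two_le_chromaticNumber_iff_ne_bot.2 hL
  have hcoe : (L.chromaticNumber.toNat : ℕ∞) = L.chromaticNumber :=
    ENat.natCast_toNat (SimpleGraph.chromaticNumber_ne_top_iff_exists.2 ⟨_, hcol⟩)
  rw [← hcoe] at htwo
  obtain ⟨r, hχ⟩ : ∃ r, L.chromaticNumber.toNat = r + 1 :=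
    Nat.exists_eq_add_of_le' (one_le_two.trans (by exact_mod_cast htwo))
  have hr : 0 < r := by
    have : 2 ≤ L.chromaticNumber.toNat := by exact_mod_cast htwo
    omega
  have hnot : ¬ L.Colorable r := fun h => by
    have := h.chromaticNumber_le
    rw [← hcoe, hχ] at this
    have : r + 1 ≤ r := by exact_mod_cast this
    omega
  rw [hχ] at hcol
  obtain ⟨c⟩ := hcol
  have hcast : ((L.chromaticNumber.toNat : ℝ) - 1) = r := by
    rw [hχ]
    push_cast
    ring
  rw [hcast]
  refine ⟨hasDistanceCapacity_inducedClass L hL hr c hnot, fun k hk => ?_⟩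
  obtain ⟨e, he, hbound⟩ := exists_isLittleO_ncard_partiteInducedFree_le L hr c hk
  exact ⟨e, he, fun n A _ => hbound n A⟩
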